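/- Let $n\ge 0$ be an integer, let $1<p<2$ and $1/p+1/p'=1$. Write $\hat w$ for the Fourier transform on $\mathbb R^n$ (kernel $e^{-2\pi i x\cdot\xi}$), taken in the sense of tempered distributions, let $\check c$ denote the inverse transform of $c$, and identify a distribution that acts by integration against a function with that function. Let $c\in L^{p'}(\mathbb R^n)$ be complex-valued with $\|c\|_{p'}\neq 0$. Let $R(c)$ be the set of all tempered distributions $w$ for which $\hat w$ is a nonnegative, bounded, measurable function with bounded support that vanishes almost everywhere on the set where $c=0$, and for which $\int_{\mathbb R^n}|c|\,\hat w=1$. (Every such $w$ belongs to $L^{p'}(\mathbb R^n)$.) Let $K_p(c)=\inf\{\|w\|_{p'}: w\in R(c)\}$. Call $F\in L^p(\mathbb R^n)$ a *partial majorant* of $\check c$ if $\hat F\ge|c|$ (in particular, $\hat F$ is real) almost everywhere in the set where $c\ne0$. Then: 1. $\check c$ has a partial majorant in $L^p(\mathbb R^n)$ if and only if $K_p(c)>0$. 2. The closure of $R(c)$ in $L^{p'}(\mathbb R^n)$ has a unique element $h$ of minimal $L^{p'}$ norm. 3. If $K_p(c)>0$, then there is a unique partial majorant $F$ of $\check c$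 of minimal $L^p$ norm, its norm is $\|F\|_p=1/K_p(c)$, and $F=a\,h|h|^{p'-2}$ almost everywhere for some constant $a>0$. 4. The distributional support of $\hat h$ is included in the distributional support of $c$. -/

import Mathlib

open MeasureTheory
open scoped ENNReal SchwartzMap FourierTransform

namespace FourierMajorant

noncomputable section

/-- The space `ℝⁿ`, also used for the dual copy of `ℝⁿ`. -/
abbrev Rn (n : ℕ) : Type := EuclideanSpace ℝ (Fin n)

/-- The space `L^p(ℝⁿ)` of (classes of) complex-valued functions, for Lebesgue measure. -/
abbrev LpRn (n : ℕ) (p : ℝ≥0∞) : Type := Lp ℂ p (volume : Measure (Rn n))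

/-- The tempered distribution `φ ↦ ∫ φ f` given by a function `f` in `L^p(ℝⁿ)`. -/
abbrev toDistrib {n : ℕ} {p : ℝ≥0∞} [Fact (1 ≤ p)] (f : LpRn n p) : 𝓢'(Rn n, ℂ) :=
  Lp.toTemperedDistribution f

/-- The tempered distribution `T` acts by integration against the function `g`. -/
def ActsBy {n : ℕ} (T : 𝓢'(Rn n, ℂ)) (g : Rn n → ℂ) : Prop :=
  ∀ φ : 𝓢(Rn n, ℂ), Integrable (fun ξ => φ ξ * g ξ) ∧ T φ = ∫ ξ, φ ξ * g ξ

/-- The set `R(c)`: distributions `w` whose Fourier transform is a nonnegative, bounded, measurable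
function `u` with bounded support, vanishing almost everywhere on the set where `c = 0`, and with
`∫ |c| u = 1`. The Fourier transform uses the kernel `exp (-2 π i x · ξ)`. -/
def testDistributions {n : ℕ} {q : ℝ≥0∞} (c : LpRn n q) : Set (𝓢'(Rn n, ℂ)) :=
  {w | ∃ u : Rn n → ℝ, Measurable u ∧ (∀ ξ, 0 ≤ u ξ) ∧ (∃ M : ℝ, ∀ ξ, u ξ ≤ M) ∧
    Bornology.IsBounded (Function.support u) ∧
    (∀ᵐ ξ : Rn n, c ξ = 0 → u ξ = 0) ∧
    ActsBy (𝓕 w) (fun ξ => (u ξ : ℂ)) ∧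
    ∫ ξ, ‖c ξ‖ * u ξ = 1}

/-- `R(c)` as a subset of `L^q(ℝⁿ)`. -/
def R {n : ℕ} {q : ℝ≥0∞} [Fact (1 ≤ q)] (c : LpRn n q) : Set (LpRn n q) :=
  {w | toDistrib w ∈ testDistributions c}

/-- The infimum of the `L^q` norms of the members of `R(c)`. -/
def K {n : ℕ} {q : ℝ≥0∞} [Fact (1 ≤ q)] (c : LpRn n q) : ℝ :=
  sInf ((fun w : LpRn n q => ‖w‖) '' R c)

/-- The members `F` of `L^p(ℝⁿ)` that are partial majorants of the inverse transform of `c`: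
the transform of `F` is a function `G` that is real with `G ≥ |c|` almost everywhere in the set
where `c ≠ 0`. -/
def partialMajorants {n : ℕ} (p : ℝ≥0∞) {q : ℝ≥0∞} [Fact (1 ≤ p)] (c : LpRn n q) :
    Set (LpRn n p) :=
  {F | ∃ G : Rn n → ℂ, ActsBy (𝓕 (toDistrib F)) G ∧
    ∀ᵐ ξ : Rn n, c ξ ≠ 0 → (G ξ).im = 0 ∧ ‖c ξ‖ ≤ (G ξ).re}

/-- `x` is an element of smallest norm in the set `s`. -/
def IsMinNorm {V : Type*} [Norm V] (s : Set V) (x : V) : Prop :=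
  x ∈ s ∧ ∀ y ∈ s, ‖x‖ ≤ ‖y‖

end

end FourierMajorant

/-! The proof is a duality between $L^p$ and $L^q$, $q=p'$. If $F$ is a partial majorant and $w\in
R(c)$ has transform $u$, Parseval gives $\int F\bar w=\int\hat F u\ge\int|c|u=1$. This passes to the
closure of $R(c)$ (`one_le_realPairing`), so by Hölder $1\le\|F\|_p\|h\|_q$ for its minimal element
$h$: hence $K=\|h\|>0$ and $\|F\|\ge 1/K$.

Conversely, $h$ exists and is unique because the closure is convex and $L^q$ is uniformly convex for
$q\ge2$ (`existsUnique_isMinNorm`). Its first-order condition is $\mathrm{Re}\int h|h|^{q-2}\bar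
w\ge\|h\|^q$ for all $w\in R(c)$ (`norm_rpow_le_realPairing_dualMap`). Tested on the Fourier side
with normalised indicators, it says that the transform of $h|h|^{q-2}$ is at least $\|h\|^q|c|$
where $c\ne0$. If $h\ne0$, dividing by $\|h\|^q$ gives a partial majorant of norm exactly $1/\|h\|$
(`smul_dualMap_mem_partialMajorants`).

Any other minimal majorant attains equality in Hölder against $h$, which determines it
(`eq_smul_dualMap`). The support statement holds on $R(c)$ and survives limits in the sense of
distributions. -/

namespace FourierMajorant

/-! ### Convexity and smoothness of the $L^q$ norm, and the duality map. -/

section LpGeometry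

variable {α : Type*} [MeasurableSpace α] {μ : Measure α} {p q : ℝ≥0∞}

theorem norm_rpow_eq_integral (hp0 : p ≠ 0) (hp : p ≠ ∞) (f : Lp ℂ p μ) :
    ‖f‖ ^ p.toReal = ∫ x, ‖f x‖ ^ p.toReal ∂μ := by
  have hpos : 0 < p.toReal := ENNReal.toReal_pos hp0 hp
  have h0 : 0 ≤ ∫ x, ‖f x‖ ^ p.toReal ∂μ := integral_nonneg fun x => by positivity
  rw [Lp.norm_def, (Lp.memLp f).eLpNorm_eq_integral_rpow_norm hp0 hp,
    ENNReal.toReal_ofReal (by positivity), ← Real.rpow_mul h0, inv_mul_cancel₀ hpos.ne',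
    Real.rpow_one]

/-- Superadditivity of $t\mapsto t^{r/2}$, then the parallelogram law, then convexity of the same
power. -/
theorem half_add_rpow_add_half_sub_rpow_le {r : ℝ} (hr : 2 ≤ r) (a b : ℂ) :
    ‖(2⁻¹ : ℝ) • (a + b)‖ ^ r + ‖(2⁻¹ : ℝ) • (a - b)‖ ^ r ≤ (‖a‖ ^ r + ‖b‖ ^ r) / 2 := by
  have hs : 1 ≤ r / 2 := by linarith
  have key (z : ℂ) : ‖z‖ ^ r = (‖z‖ ^ 2) ^ (r / 2) := by
    rw [← Real.rpow_natCast_mul (norm_nonneg _)]; congr 1; push_cast; ring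
  have hpar : ‖(2⁻¹ : ℝ) • (a + b)‖ ^ 2 + ‖(2⁻¹ : ℝ) • (a - b)‖ ^ 2
      = 2⁻¹ * ‖a‖ ^ 2 + 2⁻¹ * ‖b‖ ^ 2 := by
    have := parallelogram_law_with_norm ℝ a b
    rw [norm_smul, norm_smul, Real.norm_of_nonneg (by norm_num : (0 : ℝ) ≤ 2⁻¹)]
    nlinarith
  calc ‖(2⁻¹ : ℝ) • (a + b)‖ ^ r + ‖(2⁻¹ : ℝ) • (a - b)‖ ^ r
      ≤ (‖(2⁻¹ : ℝ) • (a + b)‖ ^ 2 + ‖(2⁻¹ : ℝ) • (a - b)‖ ^ 2) ^ (r / 2) := by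
        rw [key, key]
        exact Real.add_rpow_le_rpow_add (by positivity) (by positivity) hs
    _ ≤ 2⁻¹ * (‖a‖ ^ 2) ^ (r / 2) + 2⁻¹ * (‖b‖ ^ 2) ^ (r / 2) := by
        rw [hpar]
        exact (convexOn_rpow hs).2 (Set.mem_Ici.2 (by positivity)) (Set.mem_Ici.2 (by positivity))
          (by norm_num) (by norm_num) (by norm_num)
    _ = _ := by rw [key a, key b]; ring

theorem integrable_norm_rpow (hp0 : p ≠ 0) (hp : p ≠ ∞) (f : Lp ℂ p μ) :
    Integrable (fun x => ‖f x‖ ^ p.toReal) μ :=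
  (Lp.memLp f).integrable_norm_rpow hp0 hp

/-- Clarkson's inequality for exponents at least two. -/
theorem clarkson [Fact (1 ≤ q)] (hq2 : 2 ≤ q) (hq : q ≠ ∞) (f g : Lp ℂ q μ) :
    ‖(2⁻¹ : ℝ) • (f + g)‖ ^ q.toReal + ‖(2⁻¹ : ℝ) • (f - g)‖ ^ q.toReal
      ≤ (‖f‖ ^ q.toReal + ‖g‖ ^ q.toReal) / 2 := by
  have hq0 : q ≠ 0 := (lt_of_lt_of_le (by norm_num) hq2).ne'
  have hr : 2 ≤ q.toReal := by simpa using ENNReal.toReal_mono hq hq2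
  have hi := integrable_norm_rpow (μ := μ) hq0 hq
  simp only [norm_rpow_eq_integral hq0 hq]
  rw [← integral_add (hi _) (hi _), ← integral_add (hi _) (hi _), ← integral_div]
  refine integral_mono_ae ((hi _).add (hi _)) (((hi _).add (hi _)).div_const _) ?_
  filter_upwards [Lp.coeFn_smul (2⁻¹ : ℝ) (f + g), Lp.coeFn_smul (2⁻¹ : ℝ) (f - g),
    Lp.coeFn_add f g, Lp.coeFn_sub f g] with x h1 h2 h3 h4
  simp only [Pi.smul_apply, Pi.add_apply, Pi.sub_apply] at h1 h2 h3 h4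
  simp only [h1, h2, h3, h4]
  exact half_add_rpow_add_half_sub_rpow_le hr _ _

/-- The midpoint of $f$ and $g$ lies in `s`, so its norm is at least $d$, and Clarkson controls the
difference. This makes minimising sequences Cauchy and minimisers unique. -/
theorem norm_half_sub_rpow_le [Fact (1 ≤ q)] (hq2 : 2 ≤ q) (hq : q ≠ ∞) {s : Set (Lp ℂ q μ)}
    (hs : Convex ℝ s) {d : ℝ} (hd0 : 0 ≤ d) (hd : ∀ y ∈ s, d ≤ ‖y‖) {f g : Lp ℂ q μ}
    (hf : f ∈ s) (hg : g ∈ s) :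
    ‖(2⁻¹ : ℝ) • (f - g)‖ ^ q.toReal
      ≤ (‖f‖ ^ q.toReal + ‖g‖ ^ q.toReal) / 2 - d ^ q.toReal := by
  have hm : (2⁻¹ : ℝ) • (f + g) ∈ s := by
    rw [smul_add]; exact hs hf hg (by norm_num) (by norm_num) (by norm_num)
  have := Real.rpow_le_rpow hd0 (hd _ hm) (ENNReal.toReal_nonneg (a := q))
  linarith [clarkson hq2 hq f g]

theorem existsUnique_isMinNorm [Fact (1 ≤ q)] (hq2 : 2 ≤ q) (hq : q ≠ ∞) {s : Set (Lp ℂ q μ)}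
    (hs : Convex ℝ s) (hc : IsClosed s) (hne : s.Nonempty) : ∃! h, IsMinNorm s h := by
  have hr : 2 ≤ q.toReal := by simpa using ENNReal.toReal_mono hq hq2
  set d : ℝ := sInf ((fun w : Lp ℂ q μ => ‖w‖) '' s) with hdef
  have hbdd : BddBelow ((fun w : Lp ℂ q μ => ‖w‖) '' s) :=
    ⟨0, by rintro _ ⟨w, -, rfl⟩; exact norm_nonneg _⟩
  have hd0 : 0 ≤ d := Real.sInf_nonneg (by rintro _ ⟨w, -, rfl⟩; exact norm_nonneg _)
  have hd : ∀ y ∈ s, d ≤ ‖y‖ := fun y hy => csInf_le hbdd ⟨y, hy, rfl⟩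
  obtain ⟨v, -, hvlim, hvmem⟩ := exists_seq_tendsto_sInf (hne.image _) hbdd
  choose w hws hwv using hvmem
  have hwlim : Filter.Tendsto (fun k => ‖w k‖ ^ q.toReal) Filter.atTop
      (nhds (d ^ q.toReal)) := by
    simp only at hwv
    simp only [hwv]
    exact hvlim.rpow_const (Or.inr (by linarith))
  have hcau : CauchySeq w := by
    rw [Metric.cauchySeq_iff']
    intro ε hε
    have hε' : 0 < (ε / 2) ^ q.toReal := by positivity
    obtain ⟨N, hN⟩ := Filter.eventually_atTop.1
      (hwlim.eventually (gt_mem_nhds (lt_add_of_pos_right _ hε')))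
    refine ⟨N, fun n hn => ?_⟩
    have h1 := norm_half_sub_rpow_le hq2 hq hs hd0 hd (hws n) (hws N)
    have h2 : ‖(2⁻¹ : ℝ) • (w n - w N)‖ ^ q.toReal < (ε / 2) ^ q.toReal := by
      linarith [hN n hn, hN N le_rfl]
    have h3 := (Real.rpow_lt_rpow_iff (norm_nonneg _) (by positivity) (by linarith)).1 h2
    rw [norm_smul, Real.norm_of_nonneg (by norm_num)] at h3
    rw [dist_eq_norm]
    linarith
  obtain ⟨h, hh⟩ := cauchySeq_tendsto_of_complete hcau
  have hmem : h ∈ s := hc.mem_of_tendsto hh (Filter.Eventually.of_forall hws)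
  have hnorm : ‖h‖ = d := by
    refine tendsto_nhds_unique hh.norm ?_
    simp only at hwv
    simpa only [hwv] using hvlim
  refine ⟨h, ⟨hmem, fun y hy => hnorm ▸ hd y hy⟩, fun g hg => ?_⟩
  have hgn : ‖g‖ = d := le_antisymm (hnorm ▸ hg.2 h hmem) (hd g hg.1)
  have h1 := norm_half_sub_rpow_le hq2 hq hs hd0 hd hg.1 hmem
  rw [hgn, hnorm, add_self_div_two, sub_self] at h1
  have h2 : ‖(2⁻¹ : ℝ) • (g - h)‖ = 0 := by
    by_contra hne0
    have : 0 < ‖(2⁻¹ : ℝ) • (g - h)‖ := lt_of_le_of_ne (norm_nonneg _) (Ne.symm hne0)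
    linarith [Real.rpow_pos_of_pos this q.toReal]
  have h3 : (2⁻¹ : ℝ) • (g - h) = 0 := norm_eq_zero.1 h2
  exact sub_eq_zero.1 ((smul_eq_zero.1 h3).resolve_left (by norm_num))

theorem norm_mul_norm_rpow (z : ℂ) {r : ℝ} (hr : 1 < r) :
    ‖z * ((‖z‖ ^ (r - 2) : ℝ) : ℂ)‖ = ‖z‖ ^ (r - 1) := by
  rw [norm_mul, Complex.norm_real, Real.norm_of_nonneg (by positivity)]
  rcases eq_or_ne z 0 with rfl | hz
  · simp [Real.zero_rpow (by linarith : r - 1 ≠ 0)]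
  · have := norm_pos_iff.2 hz
    rw [← Real.rpow_one_add' (norm_nonneg _) (by linarith)]
    congr 1; ring

theorem norm_mul_norm_rpow_rpow {p q : ℝ} (hpq : p.HolderConjugate q) (z : ℂ) :
    ‖z * ((‖z‖ ^ (q - 2) : ℝ) : ℂ)‖ ^ p = ‖z‖ ^ q := by
  rw [norm_mul_norm_rpow z hpq.symm.lt, ← Real.rpow_mul (norm_nonneg _)]
  congr 1
  linarith [hpq.mul_eq_add, mul_comm p q]

theorem memLp_mul_norm_rpow (hpq : p.toReal.HolderConjugate q.toReal) {f : α → ℂ}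
    (hf : MemLp f q μ) : MemLp (fun x => f x * ((‖f x‖ ^ (q.toReal - 2) : ℝ) : ℂ)) p μ := by
  have hp0 := ENNReal.toReal_pos_iff.1 hpq.pos
  have hq0 := ENNReal.toReal_pos_iff.1 hpq.symm.pos
  have hm : AEStronglyMeasurable (fun x => f x * ((‖f x‖ ^ (q.toReal - 2) : ℝ) : ℂ)) μ := by
    have := hf.1.aemeasurable
    exact AEMeasurable.aestronglyMeasurable (by fun_prop)
  rw [← integrable_norm_rpow_iff hm hp0.1.ne' hp0.2.ne]
  simp only [norm_mul_norm_rpow_rpow hpq]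
  exact hf.integrable_norm_rpow hq0.1.ne' hq0.2.ne

/-- The duality map `h ↦ h |h|^(q-2)` from `L^q` to `L^p`. -/
noncomputable def dualMap (hpq : p.toReal.HolderConjugate q.toReal) (h : Lp ℂ q μ) : Lp ℂ p μ :=
  (memLp_mul_norm_rpow hpq (Lp.memLp h)).toLp

theorem coeFn_dualMap (hpq : p.toReal.HolderConjugate q.toReal) (h : Lp ℂ q μ) :
    dualMap hpq h =ᵐ[μ] fun x => h x * ((‖h x‖ ^ (q.toReal - 2) : ℝ) : ℂ) :=
  MemLp.coeFn_toLp _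

theorem norm_dualMap_rpow (hpq : p.toReal.HolderConjugate q.toReal) (h : Lp ℂ q μ) :
    ‖dualMap hpq h‖ ^ p.toReal = ‖h‖ ^ q.toReal := by
  have hp0 := ENNReal.toReal_pos_iff.1 hpq.pos
  have hq0 := ENNReal.toReal_pos_iff.1 hpq.symm.pos
  rw [norm_rpow_eq_integral hp0.1.ne' hp0.2.ne, norm_rpow_eq_integral hq0.1.ne' hq0.2.ne]
  refine integral_congr_ae ?_
  filter_upwards [coeFn_dualMap hpq h] with x hx
  rw [hx, norm_mul_norm_rpow_rpow hpq]

variable [Fact (1 ≤ p)] [Fact (1 ≤ q)]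

theorem norm_dualMap (hpq : p.toReal.HolderConjugate q.toReal) (h : Lp ℂ q μ) :
    ‖dualMap hpq h‖ = ‖h‖ ^ (q.toReal - 1) := by
  have h1 := norm_dualMap_rpow hpq h
  have h2 : ‖h‖ ^ q.toReal = (‖h‖ ^ (q.toReal - 1)) ^ p.toReal := by
    rw [← Real.rpow_mul (norm_nonneg _)]
    congr 1
    linarith [hpq.mul_eq_add, mul_comm p.toReal q.toReal]
  rw [h2] at h1
  exact (Real.rpow_left_inj (norm_nonneg _) (by positivity) hpq.pos.ne').1 h1

variable [p.HolderConjugate q]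

variable (μ p q) in
/-- The real pairing `∫ Re (conj F * w)` of `L^p` and `L^q`. -/
noncomputable def realPairing : Lp ℂ p μ →L[ℝ] Lp ℂ q μ →L[ℝ] ℝ :=
  ContinuousLinearMap.lpPairing μ p q (innerSL ℝ)

theorem realPairing_apply (F : Lp ℂ p μ) (w : Lp ℂ q μ) :
    realPairing μ p q F w = ∫ x, inner ℝ (F x) (w x) ∂μ :=
  ContinuousLinearMap.lpPairing_eq_integral _ _ _

theorem realPairing_le (F : Lp ℂ p μ) (w : Lp ℂ q μ) :
    realPairing μ p q F w ≤ ‖F‖ * ‖w‖ := by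
  let B : ℂ →L[ℝ] ℂ →L[ℝ] ℝ := innerSL ℝ
  have h1 : realPairing μ p q F w = L1.integral (B.holder 1 F w) := by
    rw [realPairing_apply, L1.integral_eq_integral]
    exact (integral_congr_ae (B.coeFn_holder F w)).symm
  rw [h1]
  refine (Real.le_norm_self _).trans ((L1.norm_integral_le _).trans ?_)
  refine (B.norm_holder_apply_apply_le F w).trans ?_
  have hB : ‖B‖ ≤ 1 := norm_innerSL_le ℝ
  calc ‖B‖ * ‖F‖ * ‖w‖ ≤ 1 * ‖F‖ * ‖w‖ := by gcongr
    _ = _ := by ring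

theorem inner_mul_norm_rpow_self {r : ℝ} (hr : 0 < r) (z : ℂ) :
    inner ℝ (z * ((‖z‖ ^ (r - 2) : ℝ) : ℂ)) z = ‖z‖ ^ r := by
  rw [mul_comm, ← Complex.real_smul, real_inner_smul_left, real_inner_self_eq_norm_sq]
  rcases eq_or_ne z 0 with rfl | hz
  · simp [hr.ne']
  · rw [← Real.rpow_natCast, ← Real.rpow_add (norm_pos_iff.2 hz)]
    congr 1; push_cast; ring

theorem realPairing_dualMap_self (hpq : p.toReal.HolderConjugate q.toReal) (h : Lp ℂ q μ) :
    realPairing μ p q (dualMap hpq h) h = ‖h‖ ^ q.toReal := by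
  have hq0 := ENNReal.toReal_pos_iff.1 hpq.symm.pos
  rw [realPairing_apply, norm_rpow_eq_integral hq0.1.ne' hq0.2.ne]
  refine integral_congr_ae ?_
  filter_upwards [coeFn_dualMap hpq h] with x hx
  rw [hx, inner_mul_norm_rpow_self hpq.symm.pos]

/-- The pairing of $F$ with its own dual element $F|F|^{p-2}\in L^q$ is $\|F\|^p$. -/
theorem eq_zero_of_realPairing_eq_zero (hpq : p.toReal.HolderConjugate q.toReal) {F : Lp ℂ p μ}
    (hF : ∀ w, realPairing μ p q F w = 0) : F = 0 := by
  have hp0 := ENNReal.toReal_pos_iff.1 hpq.pos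
  have h1 := hF (dualMap hpq.symm F)
  rw [realPairing_apply] at h1
  have h2 : ‖F‖ ^ p.toReal = 0 := by
    rw [norm_rpow_eq_integral hp0.1.ne' hp0.2.ne, ← h1]
    refine integral_congr_ae ?_
    filter_upwards [coeFn_dualMap hpq.symm F] with x hx
    rw [hx, real_inner_comm, inner_mul_norm_rpow_self hpq.pos]
  exact norm_eq_zero.1 ((Real.rpow_eq_zero (norm_nonneg _) hpq.pos.ne').1 h2)

/-- Differentiation under the integral sign. Since $q-2\ge0$, for $|t|<1$ the derivative of the
integrand is dominated by $q(|h|+|v|)^q$, which is integrable. -/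
theorem hasDerivAt_norm_add_smul_rpow (hpq : p.toReal.HolderConjugate q.toReal) (hq2 : 2 ≤ q.toReal)
    (h v : Lp ℂ q μ) :
    HasDerivAt (fun t : ℝ => ‖h + t • v‖ ^ q.toReal)
      (q.toReal * realPairing μ p q (dualMap hpq h) v) 0 := by
  have hq0 := ENNReal.toReal_pos_iff.1 hpq.symm.pos
  have hnorm (t : ℝ) : ‖h + t • v‖ ^ q.toReal = ∫ x, ‖h x + t • v x‖ ^ q.toReal ∂μ := by
    rw [norm_rpow_eq_integral hq0.1.ne' hq0.2.ne]
    refine integral_congr_ae ?_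
    filter_upwards [Lp.coeFn_add h (t • v), Lp.coeFn_smul t v] with x h1 h2
    rw [h1, Pi.add_apply, h2, Pi.smul_apply]
  simp only [hnorm]
  have hh := (Lp.aestronglyMeasurable h).aemeasurable
  have hv := (Lp.aestronglyMeasurable v).aemeasurable
  have hb : Integrable (fun x => q.toReal * (‖h x‖ + ‖v x‖) ^ q.toReal) μ := by
    have := ((Lp.memLp h).norm.add (Lp.memLp v).norm).integrable_norm_rpow hq0.1.ne' hq0.2.ne
    refine (this.const_mul q.toReal).congr (Filter.Eventually.of_forall fun x => ?_)
    simp only [Pi.add_apply]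
    rw [Real.norm_of_nonneg (by positivity)]
  have key := (hasDerivAt_integral_of_dominated_loc_of_deriv_le (μ := μ) (x₀ := (0 : ℝ))
    (s := Metric.ball 0 1) (F := fun t x => ‖h x + t • v x‖ ^ q.toReal)
    (F' := fun t x => q.toReal * ‖h x + t • v x‖ ^ (q.toReal - 2) * inner ℝ (h x + t • v x) (v x))
    (bound := fun x => q.toReal * (‖h x‖ + ‖v x‖) ^ q.toReal)
    (Metric.ball_mem_nhds _ one_pos)
    (Filter.Eventually.of_forall fun t => AEMeasurable.aestronglyMeasurable (by fun_prop))
    (by simpa using integrable_norm_rpow hq0.1.ne' hq0.2.ne h)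
    (AEMeasurable.aestronglyMeasurable (by fun_prop))
    (Filter.Eventually.of_forall fun x t ht => ?_) hb
    (Filter.Eventually.of_forall fun x t _ => ?_)).2
  · refine key.congr_deriv ?_
    symm
    rw [realPairing_apply, ← integral_const_mul]
    refine integral_congr_ae ?_
    filter_upwards [coeFn_dualMap hpq h] with x hx
    rw [hx, mul_comm (h x), ← Complex.real_smul, real_inner_smul_left]
    simp only [zero_smul, add_zero, mul_assoc]
  · have hle : ‖h x + t • v x‖ ≤ ‖h x‖ + ‖v x‖ := by
      refine (norm_add_le _ _).trans ?_
      rw [norm_smul]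
      have : ‖t‖ ≤ 1 := (mem_ball_zero_iff.1 ht).le
      nlinarith [norm_nonneg (v x)]
    have h0 : 0 ≤ ‖h x‖ + ‖v x‖ := by positivity
    rw [norm_mul, norm_mul, Real.norm_of_nonneg (by positivity : (0 : ℝ) ≤ q.toReal),
      Real.norm_of_nonneg (by positivity), mul_assoc]
    refine mul_le_mul_of_nonneg_left ?_ (by positivity)
    calc ‖h x + t • v x‖ ^ (q.toReal - 2) * ‖(inner ℝ (h x + t • v x) (v x) : ℝ)‖
        ≤ (‖h x‖ + ‖v x‖) ^ (q.toReal - 2) * (‖h x‖ + ‖v x‖) ^ 2 := by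
          refine mul_le_mul (Real.rpow_le_rpow (norm_nonneg _) hle (by linarith)) ?_
            (norm_nonneg _) (by positivity)
          refine (norm_inner_le_norm _ _).trans ?_
          nlinarith [norm_nonneg (h x), norm_nonneg (v x), norm_nonneg (h x + t • v x)]
      _ = (‖h x‖ + ‖v x‖) ^ q.toReal := by
          rw [← Real.rpow_natCast, ← Real.rpow_add' h0] <;> push_cast
          · congr 1; ring
          · linarith
  · have h1 : HasDerivAt (fun t : ℝ => h x + t • v x) (v x) t := by
      simpa using ((hasDerivAt_id t).smul_const (v x)).const_add (h x)
    have h2 := (hasFDerivAt_norm_rpow (h x + t • v x) hpq.symm.lt).comp_hasDerivAt t h1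
    simpa only [Function.comp_def, smul_apply, smul_eq_mul, innerSL_apply_apply] using h2

/-- The segment from $h$ to $w$ stays in `s`, so $\|h+t(w-h)\|^q$ has nonnegative right derivative
at $t=0$. -/
theorem norm_rpow_le_realPairing_dualMap (hpq : p.toReal.HolderConjugate q.toReal)
    (hq2 : 2 ≤ q.toReal) {s : Set (Lp ℂ q μ)} (hs : Convex ℝ s) {h w : Lp ℂ q μ}
    (hh : IsMinNorm s h) (hw : w ∈ s) :
    ‖h‖ ^ q.toReal ≤ realPairing μ p q (dualMap hpq h) w := by
  have hd := hasDerivAt_norm_add_smul_rpow hpq hq2 h (w - h)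
  have hnn : 0 ≤ q.toReal * realPairing μ p q (dualMap hpq h) (w - h) := by
    have hlim := (hasDerivAt_iff_tendsto_slope_zero.1 hd).mono_left
      (nhdsWithin_mono (0 : ℝ) (fun t (ht : t ∈ Set.Ioi 0) => (ne_of_gt ht : t ≠ 0)))
    refine ge_of_tendsto hlim ?_
    filter_upwards [Ioo_mem_nhdsGT (one_pos : (0 : ℝ) < 1)] with t ht
    have hmem : h + t • (w - h) ∈ s := hs.add_smul_sub_mem hh.1 hw ⟨ht.1.le, ht.2.le⟩
    have := Real.rpow_le_rpow (norm_nonneg _) (hh.2 _ hmem) hpq.symm.pos.le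
    simp only [zero_add, zero_smul, add_zero, smul_eq_mul]
    exact mul_nonneg (inv_nonneg.2 ht.1.le) (sub_nonneg.2 this)
  rw [map_sub, realPairing_dualMap_self] at hnn
  have := nonneg_of_mul_nonneg_right hnn hpq.symm.pos
  linarith

/-- The equality case of Hölder, obtained from smoothness of the norm: a differentiable nonnegative
function vanishing at $0$ has zero derivative there, in every direction $v$. -/
theorem eq_smul_dualMap (hpq : p.toReal.HolderConjugate q.toReal) (hq2 : 2 ≤ q.toReal)
    {F : Lp ℂ p μ} {h : Lp ℂ q μ} (hle : ‖F‖ * ‖h‖ ≤ 1) (hge : 1 ≤ realPairing μ p q F h) :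
    F = (‖h‖ ^ q.toReal)⁻¹ • dualMap hpq h := by
  have hprod : ‖F‖ * ‖h‖ = 1 := le_antisymm hle (hge.trans (realPairing_le F h))
  have hFh : realPairing μ p q F h = 1 := le_antisymm ((realPairing_le F h).trans hle) hge
  have hh0 : 0 < ‖h‖ := lt_of_le_of_ne (norm_nonneg _) (by rintro h0; simp [← h0] at hprod)
  have hFn : ‖F‖ = ‖h‖⁻¹ := eq_inv_of_mul_eq_one_left hprod
  refine (sub_eq_zero.1 (eq_zero_of_realPairing_eq_zero hpq fun v => ?_)).symm
  -- The pairing of $F$ with $h+tv$ is $1+t\langle F,v\rangle$ and is at most $b=\|h+tv\|/\|h\|$;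
  -- Young gives $b\le 1/p+b^q/q$. `Ψ` is the resulting gap, zero at $t=0$.
  let Ψ : ℝ → ℝ := fun t => (‖h‖ ^ q.toReal)⁻¹ / q.toReal * ‖h + t • v‖ ^ q.toReal + p.toReal⁻¹
    - (1 + t * realPairing μ p q F v)
  have hΨ (t : ℝ) : 0 ≤ Ψ t := by
    have h1 := realPairing_le F (h + t • v)
    rw [map_add, map_smul, hFh, smul_eq_mul, hFn] at h1
    have h2 := Real.young_inequality_of_nonneg (a := 1) (b := ‖h‖⁻¹ * ‖h + t • v‖) zero_le_one
      (by positivity) hpq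
    rw [one_mul, Real.one_rpow, Real.mul_rpow (by positivity) (norm_nonneg _),
      Real.inv_rpow (norm_nonneg _)] at h2
    have h3 : (‖h‖ ^ q.toReal)⁻¹ * ‖h + t • v‖ ^ q.toReal / q.toReal
      = (‖h‖ ^ q.toReal)⁻¹ / q.toReal * ‖h + t • v‖ ^ q.toReal := by ring
    simp only [Ψ]
    rw [one_div] at h2
    linarith
  have hΨ0 : Ψ 0 = 0 := by
    have : ‖h‖ ^ q.toReal ≠ 0 := by positivity
    have h4 := hpq.inv_add_inv_eq_one
    simp only [Ψ, zero_smul, add_zero, zero_mul]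
    rw [div_mul_eq_mul_div, inv_mul_cancel₀ this, one_div]
    linarith
  have hmin : IsLocalMin Ψ 0 := Filter.Eventually.of_forall fun t => hΨ0.le.trans (hΨ t)
  have hder : HasDerivAt Ψ ((‖h‖ ^ q.toReal)⁻¹ / q.toReal *
      (q.toReal * realPairing μ p q (dualMap hpq h) v) - 1 * realPairing μ p q F v) 0 :=
    (((hasDerivAt_norm_add_smul_rpow hpq hq2 h v).const_mul _).add_const _).sub
      (((hasDerivAt_id (0 : ℝ)).mul_const _).const_add _)
  have h5 := hmin.hasDerivAt_eq_zero hder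
  have hq' : q.toReal ≠ 0 := hpq.symm.pos.ne'
  rw [map_sub, map_smul, sub_apply, smul_apply, smul_eq_mul]
  rw [← h5]
  field_simp

end LpGeometry

end FourierMajorant

namespace FourierMajorant

/-! ### Fourier transforms of $L^p$ functions as distributions, and Parseval's formula. -/

section Transform

variable {n : ℕ}

theorem integral_fourier_mul {f g : Rn n → ℂ} (hf : Integrable f) (hg : Integrable g) :
    ∫ x, 𝓕 f x * g x = ∫ x, f x * 𝓕 g x := by
  simpa using! VectorFourier.integral_bilin_fourierIntegral_eq_flip (ContinuousLinearMap.mul ℂ ℂ)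
    (L := innerₗ (Rn n)) Real.continuous_fourierChar continuous_inner hf hg

theorem integral_fourierInv_mul {f g : Rn n → ℂ} (hf : Integrable f) (hg : Integrable g) :
    ∫ x, 𝓕⁻ f x * g x = ∫ x, f x * 𝓕⁻ g x := by
  have h := integral_fourier_mul hf (hg.comp_neg)
  rw [← integral_neg_eq_self] at h
  simp only [neg_neg, ← Real.fourierInv_eq_fourier_neg] at h
  simpa only [← Real.fourierInv_eq_fourier_comp_neg] using h

theorem continuous_fourier {f : Rn n → ℂ} (hf : Integrable f) : Continuous (𝓕 f) :=
  VectorFourier.fourierIntegral_continuous Real.continuous_fourierChar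
    (innerSL ℝ).continuous₂ hf

theorem continuous_fourierInv {f : Rn n → ℂ} (hf : Integrable f) : Continuous (𝓕⁻ f) := by
  have h : 𝓕⁻ f = fun x => 𝓕 f (-x) := funext fun x => Real.fourierInv_eq_fourier_neg f x
  rw [h]
  exact (continuous_fourier hf).comp continuous_neg

theorem norm_fourier_le (f : Rn n → ℂ) (x : Rn n) : ‖𝓕 f x‖ ≤ ∫ v, ‖f v‖ :=
  VectorFourier.norm_fourierIntegral_le_integral_norm _ _ _ _ _

theorem norm_fourierInv_le (f : Rn n → ℂ) (x : Rn n) : ‖𝓕⁻ f x‖ ≤ ∫ v, ‖f v‖ := by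
  rw [Real.fourierInv_eq_fourier_neg]
  exact norm_fourier_le f _

theorem conj_fourierInv_ofReal (u : Rn n → ℝ) (x : Rn n) :
    starRingEnd ℂ (𝓕⁻ (fun ξ => (u ξ : ℂ)) x) = 𝓕 (fun ξ => (u ξ : ℂ)) x := by
  rw [Real.fourierInv_eq, Real.fourier_eq, ← integral_conj]
  refine integral_congr_ae (Filter.Eventually.of_forall fun v => ?_)
  simp only [Circle.smul_def, smul_eq_mul, map_mul, Complex.conj_ofReal, AddChar.map_neg_eq_inv,
    Circle.coe_inv_eq_conj]

/-- `ActsBy` demands integrability against every Schwartz function, in particular against a bump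
equal to $1$ on a given compact set. -/
theorem ActsBy.locallyIntegrable {T : 𝓢'(Rn n, ℂ)} {G : Rn n → ℂ} (h : ActsBy T G) :
    LocallyIntegrable G := by
  rw [locallyIntegrable_iff]
  intro k hk
  obtain ⟨r, hr⟩ := hk.isBounded.subset_closedBall 0
  let b : ContDiffBump (0 : Rn n) := ⟨|r| + 1, |r| + 2, by positivity, by linarith⟩
  have hb₁ : HasCompactSupport (Complex.ofRealCLM ∘ b) := b.hasCompactSupport.comp_left rfl
  have hb₂ : ContDiff ℝ ((⊤ : ℕ∞) : WithTop ℕ∞) (Complex.ofRealCLM ∘ b) :=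
    Complex.ofRealCLM.contDiff.comp b.contDiff
  refine ((h (hb₁.toSchwartzMap hb₂)).1.integrableOn (s := k)).congr_fun_ae ?_
  filter_upwards [ae_restrict_mem hk.measurableSet] with x hx
  have : b x = 1 := b.one_of_mem_closedBall
    (Metric.closedBall_subset_closedBall (by simp only [b]; linarith [le_abs_self r]) (hr hx))
  simp [this]

theorem ActsBy.ae_eq {T : 𝓢'(Rn n, ℂ)} {G G' : Rn n → ℂ} (h : ActsBy T G) (h' : ActsBy T G') :
    G =ᵐ[volume] G' := by
  refine ae_eq_of_integral_contDiff_smul_eq h.locallyIntegrable h'.locallyIntegrable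
    fun g hg hc => ?_
  have hg₁ : HasCompactSupport (Complex.ofRealCLM ∘ g) := hc.comp_left rfl
  have hg₂ : ContDiff ℝ ((⊤ : ℕ∞) : WithTop ℕ∞) (Complex.ofRealCLM ∘ g) :=
    Complex.ofRealCLM.contDiff.comp hg
  have h1 := (h (hg₁.toSchwartzMap hg₂)).2.symm.trans (h' (hg₁.toSchwartzMap hg₂)).2
  simpa using h1

theorem ActsBy.unique {T T' : 𝓢'(Rn n, ℂ)} {G : Rn n → ℂ} (h : ActsBy T G) (h' : ActsBy T' G) :
    T = T' := by
  ext φ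
  rw [(h φ).2, (h' φ).2]

theorem ActsBy.add {T T' : 𝓢'(Rn n, ℂ)} {G G' : Rn n → ℂ} (h : ActsBy T G) (h' : ActsBy T' G') :
    ActsBy (T + T') (fun ξ => G ξ + G' ξ) := by
  intro φ
  simp only [mul_add]
  refine ⟨(h φ).1.add (h' φ).1, ?_⟩
  rw [integral_add (h φ).1 (h' φ).1, ← (h φ).2, ← (h' φ).2]
  rfl

theorem ActsBy.smul {T : 𝓢'(Rn n, ℂ)} {G : Rn n → ℂ} (h : ActsBy T G) (a : ℂ) :
    ActsBy (a • T) (fun ξ => a * G ξ) := by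
  intro φ
  simp only [mul_left_comm _ a]
  refine ⟨(h φ).1.const_mul a, ?_⟩
  rw [integral_const_mul, ← (h φ).2]
  rfl

theorem integrable_schwartz_mul {p : ℝ≥0∞} (hp : 1 ≤ p) {f : Rn n → ℂ} (hf : MemLp f p)
    (φ : 𝓢(Rn n, ℂ)) : Integrable (fun x => φ x * f x) := by
  have := ENNReal.HolderConjugate.inv_one_sub_inv' hp
  have : ((1 - p⁻¹)⁻¹).HolderConjugate p := ENNReal.HolderConjugate.symm
  exact (φ.memLp (1 - p⁻¹)⁻¹).integrable_mul hf

theorem actsBy_toDistrib {p : ℝ≥0∞} [hp : Fact (1 ≤ p)] (f : LpRn n p) : ActsBy (toDistrib f) f :=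
  fun φ => ⟨integrable_schwartz_mul hp.out (Lp.memLp f) φ, by
    simp [Lp.toTemperedDistribution_apply]⟩

theorem toDistrib_injective {p : ℝ≥0∞} [Fact (1 ≤ p)] :
    Function.Injective (toDistrib : LpRn n p → 𝓢'(Rn n, ℂ)) := by
  intro f g h
  refine Lp.ext ?_
  have hf := actsBy_toDistrib f
  rw [h] at hf
  exact hf.ae_eq (actsBy_toDistrib g)

theorem eq_of_actsBy_fourier {p : ℝ≥0∞} [Fact (1 ≤ p)] {f g : LpRn n p} {G : Rn n → ℂ}
    (hf : ActsBy (𝓕 (toDistrib f)) G) (hg : ActsBy (𝓕 (toDistrib g)) G) : f = g := by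
  apply toDistrib_injective
  have h := congrArg (fun T : 𝓢'(Rn n, ℂ) => 𝓕⁻ T) (hf.unique hg)
  simpa only [FourierTransform.fourierInv_fourier_eq] using h

/-- The Plancherel extension and the integral formula define the same tempered distribution, hence
agree almost everywhere. -/
theorem coeFn_fourierInv_toLp {f : Rn n → ℂ} (hf : Integrable f) (hf2 : MemLp f 2) :
    (𝓕⁻ hf2.toLp : LpRn n 2) =ᵐ[volume] 𝓕⁻ f := by
  refine (actsBy_toDistrib (𝓕⁻ hf2.toLp : LpRn n 2)).ae_eq fun φ => ⟨?_, ?_⟩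
  · exact φ.integrable.mul_bdd (c := ∫ v, ‖f v‖) (continuous_fourierInv hf).aestronglyMeasurable
      (Filter.Eventually.of_forall (norm_fourierInv_le f))
  · rw [toDistrib, ← Lp.fourierInv_toTemperedDistribution_eq,
      TemperedDistribution.fourierInv_apply, Lp.toTemperedDistribution_apply,
      ← integral_fourierInv_mul φ.integrable hf, ← SchwartzMap.fourierInv_coe]
    refine integral_congr_ae ?_
    filter_upwards [hf2.coeFn_toLp] with x hx
    rw [hx, smul_eq_mul]

theorem memLp_fourierInv_two {f : Rn n → ℂ} (hf : Integrable f) (hf2 : MemLp f 2) :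
    MemLp (𝓕⁻ f) 2 :=
  (memLp_congr_ae (coeFn_fourierInv_toLp hf hf2)).1 (Lp.memLp _)

/-- Interpolation with $L^\infty$: $|f|^q\le C^{q-2}|f|^2$. -/
theorem memLp_of_bounded {α : Type*} [MeasurableSpace α] {μ : Measure α} {f : α → ℂ}
    (hf2 : MemLp f 2 μ) {C : ℝ} (hC : ∀ x, ‖f x‖ ≤ C) {q : ℝ≥0∞} (hq2 : 2 ≤ q) (hq : q ≠ ∞) :
    MemLp f q μ := by
  have hq0 : q ≠ 0 := (lt_of_lt_of_le (by norm_num) hq2).ne'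
  have hr : 2 ≤ q.toReal := by simpa using ENNReal.toReal_mono hq hq2
  rw [← integrable_norm_rpow_iff hf2.1 hq0 hq]
  have h2 := (hf2.integrable_norm_rpow (by norm_num) (by norm_num)).const_mul (C ^ (q.toReal - 2))
  refine h2.mono' (hf2.1.norm.aemeasurable.pow_const _).aestronglyMeasurable
    (Filter.Eventually.of_forall fun x => ?_)
  rw [Real.norm_of_nonneg (by positivity)]
  have h0 : (0 : ℝ) ≤ ‖f x‖ := norm_nonneg _
  calc ‖f x‖ ^ q.toReal = ‖f x‖ ^ (q.toReal - 2) * ‖f x‖ ^ (2 : ℝ) := by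
        rw [← Real.rpow_add' h0 (by linarith), sub_add_cancel]
    _ ≤ C ^ (q.toReal - 2) * ‖f x‖ ^ ((2 : ℝ≥0∞).toReal) := by
        simp only [ENNReal.toReal_ofNat]
        gcongr
        exact hC x

/-- Bounded measurable functions with bounded support. -/
structure IsMultiplier (u : Rn n → ℝ) : Prop where
  measurable : Measurable u
  bounded : ∃ M : ℝ, ∀ ξ, |u ξ| ≤ M
  isBounded_support : Bornology.IsBounded (Function.support u)

theorem IsMultiplier.memLp {u : Rn n → ℝ} (hu : IsMultiplier u) (r : ℝ≥0∞) :
    MemLp (fun ξ => (u ξ : ℂ)) r := by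
  obtain ⟨M, hM⟩ := hu.bounded
  obtain ⟨ρ, hρ⟩ := hu.isBounded_support.subset_closedBall 0
  have hi : MemLp ((Metric.closedBall (0 : Rn n) ρ).indicator fun _ => M) r :=
    memLp_indicator_const r Metric.isClosed_closedBall.measurableSet M
      (Or.inr (isCompact_closedBall _ _).measure_lt_top.ne)
  refine hi.of_le (Complex.measurable_ofReal.comp hu.measurable).aestronglyMeasurable
    (Filter.Eventually.of_forall fun ξ => ?_)
  rw [Complex.norm_real, Real.norm_eq_abs]
  by_cases hξ : ξ ∈ Metric.closedBall (0 : Rn n) ρ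
  · rw [Set.indicator_of_mem hξ]
    exact (hM ξ).trans (le_abs_self M)
  · have : u ξ = 0 := by
      by_contra h0
      exact hξ (hρ h0)
    simp [this]

theorem IsMultiplier.integrable {u : Rn n → ℝ} (hu : IsMultiplier u) :
    Integrable (fun ξ => (u ξ : ℂ)) :=
  memLp_one_iff_integrable.1 (hu.memLp 1)

theorem IsMultiplier.integrable_mul {u : Rn n → ℝ} (hu : IsMultiplier u) {G : Rn n → ℂ}
    (hG : LocallyIntegrable G) : Integrable (fun ξ => G ξ * (u ξ : ℂ)) := by
  obtain ⟨M, hM⟩ := hu.bounded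
  obtain ⟨ρ, hρ⟩ := hu.isBounded_support.subset_closedBall 0
  have h1 := (locallyIntegrable_iff.1 hG) _ (isCompact_closedBall (0 : Rn n) ρ)
  have h2 : IntegrableOn (fun ξ => G ξ * (u ξ : ℂ)) (Metric.closedBall 0 ρ) :=
    Integrable.mul_bdd (c := M) h1
      (Complex.measurable_ofReal.comp hu.measurable).aestronglyMeasurable
      (Filter.Eventually.of_forall fun ξ => by simpa using hM ξ)
  refine h2.integrable_of_forall_notMem_eq_zero fun ξ hξ => ?_
  have : u ξ = 0 := by
    by_contra h0
    exact hξ (hρ h0)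
  simp [this]

theorem IsMultiplier.memLp_fourierInv {u : Rn n → ℝ} (hu : IsMultiplier u) {q : ℝ≥0∞}
    (hq2 : 2 ≤ q) (hq : q ≠ ∞) : MemLp (𝓕⁻ (fun ξ => (u ξ : ℂ))) q :=
  memLp_of_bounded (memLp_fourierInv_two hu.integrable (hu.memLp 2)) (norm_fourierInv_le _) hq2 hq

theorem IsMultiplier.actsBy_fourier {u : Rn n → ℝ} (hu : IsMultiplier u) {q : ℝ≥0∞}
    [Fact (1 ≤ q)] {w : LpRn n q} (hw : w =ᵐ[volume] 𝓕⁻ (fun ξ => (u ξ : ℂ))) :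
    ActsBy (𝓕 (toDistrib w)) (fun ξ => (u ξ : ℂ)) := by
  intro φ
  refine ⟨integrable_schwartz_mul le_rfl (hu.memLp 1) φ, ?_⟩
  have h1 := integral_fourierInv_mul (𝓕 φ).integrable hu.integrable
  rw [← SchwartzMap.fourierInv_coe, FourierTransform.fourierInv_fourier_eq] at h1
  rw [h1, TemperedDistribution.fourier_apply, toDistrib, Lp.toTemperedDistribution_apply]
  refine integral_congr_ae ?_
  filter_upwards [hw] with x hx
  rw [hx, smul_eq_mul]

theorem IsMultiplier.coeFn_of_actsBy {u : Rn n → ℝ} (hu : IsMultiplier u) {q : ℝ≥0∞}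
    [Fact (1 ≤ q)] (hq2 : 2 ≤ q) (hq : q ≠ ∞) {w : LpRn n q}
    (hw : ActsBy (𝓕 (toDistrib w)) (fun ξ => (u ξ : ℂ))) :
    w =ᵐ[volume] 𝓕⁻ (fun ξ => (u ξ : ℂ)) := by
  have h1 := (hu.memLp_fourierInv hq2 hq).coeFn_toLp
  rw [eq_of_actsBy_fourier hw (hu.actsBy_fourier h1)]
  exact h1

/-- Cut at height $1$: where $|f|>1$, $|f|\le|f|^p$; elsewhere $|f|^2\le|f|^p$. -/
theorem exists_add_memLp {α : Type*} [MeasurableSpace α] {μ : Measure α} {p : ℝ≥0∞}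
    (hp1 : 1 ≤ p) (hp2 : p ≤ 2) {f : α → ℂ} (hm : StronglyMeasurable f) (hf : MemLp f p μ) :
    ∃ g k : α → ℂ, f = g + k ∧ Integrable g μ ∧ MemLp k 2 μ := by
  have hp : p ≠ ∞ := (hp2.trans_lt (by norm_num)).ne
  have hp0 : p ≠ 0 := (lt_of_lt_of_le one_pos hp1).ne'
  have hr1 : 1 ≤ p.toReal := by simpa using ENNReal.toReal_mono hp hp1
  have hr2 : p.toReal ≤ 2 := by simpa using ENNReal.toReal_mono (by norm_num) hp2
  have hS : MeasurableSet {x | 1 < ‖f x‖} := measurableSet_lt measurable_const hm.norm.measurable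
  have hint := hf.integrable_norm_rpow hp0 hp
  refine ⟨{x | 1 < ‖f x‖}.indicator f, {x | 1 < ‖f x‖}ᶜ.indicator f,
    (Set.indicator_self_add_compl _ _).symm, ?_, ?_⟩
  · refine hint.mono' (hm.indicator hS).aestronglyMeasurable
      (Filter.Eventually.of_forall fun x => ?_)
    by_cases hx : 1 < ‖f x‖
    · rw [Set.indicator_of_mem (by exact hx)]
      exact Real.self_le_rpow_of_one_le hx.le hr1
    · rw [Set.indicator_of_notMem (by exact hx), norm_zero]
      positivity
  · rw [← integrable_norm_rpow_iff (hm.indicator hS.compl).aestronglyMeasurable (by norm_num)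
      (by norm_num)]
    refine hint.mono' ((hm.indicator hS.compl).norm.measurable.pow_const _).aestronglyMeasurable
      (Filter.Eventually.of_forall fun x => ?_)
    rw [Real.norm_of_nonneg (by positivity)]
    by_cases hx : 1 < ‖f x‖
    · rw [Set.indicator_of_notMem (by simpa using hx), norm_zero,
        Real.zero_rpow (by norm_num)]
      positivity
    · rw [Set.indicator_of_mem (by simpa using hx), ENNReal.toReal_ofNat]
      exact Real.rpow_le_rpow_of_exponent_ge' (norm_nonneg _) (not_lt.1 hx) (by linarith) hr2

/-- The Fourier transform of an `L^p` function, `1 ≤ p ≤ 2`, is a function, and Parseval's formula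
holds against inverse transforms of bounded functions with bounded support. -/
theorem exists_actsBy_fourier {p : ℝ≥0∞} [hp1 : Fact (1 ≤ p)] (hp2 : p ≤ 2) (F : LpRn n p) :
    ∃ G : Rn n → ℂ, ActsBy (𝓕 (toDistrib F)) G ∧ ∀ u : Rn n → ℝ, IsMultiplier u →
      ∫ x, F x * starRingEnd ℂ (𝓕⁻ (fun ξ => (u ξ : ℂ)) x) = ∫ ξ, G ξ * (u ξ : ℂ) := by
  -- The $L^1$ part is treated by the integral formula and Fubini, the $L^2$ part by Plancherel.
  obtain ⟨g, k, hF, hg, hk⟩ := exists_add_memLp hp1.out hp2 (Lp.stronglyMeasurable F) (Lp.memLp F)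
  have hk' := hk.coeFn_toLp
  have hG1 := (continuous_fourier hg).aestronglyMeasurable (μ := volume)
  refine ⟨fun ξ => 𝓕 g ξ + (𝓕 hk.toLp : LpRn n 2) ξ, fun φ => ?_, fun u hu => ?_⟩
  · have h1 : Integrable fun ξ => φ ξ * 𝓕 g ξ :=
      φ.integrable.mul_bdd (c := ∫ v, ‖g v‖) hG1 (Filter.Eventually.of_forall (norm_fourier_le g))
    have h2 := actsBy_toDistrib (𝓕 hk.toLp : LpRn n 2) φ
    have h3 : Integrable fun x => 𝓕 φ x * g x := by
      rw [SchwartzMap.fourier_coe]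
      exact hg.bdd_mul (continuous_fourier φ.integrable).aestronglyMeasurable
        (Filter.Eventually.of_forall (norm_fourier_le φ))
    have h4 : Integrable fun x => 𝓕 φ x * k x := integrable_schwartz_mul (by norm_num) hk (𝓕 φ)
    simp only [mul_add]
    refine ⟨h1.add h2.1, ?_⟩
    rw [integral_add h1 h2.1, ← h2.2, TemperedDistribution.fourier_apply, toDistrib, toDistrib,
      ← Lp.fourier_toTemperedDistribution_eq, TemperedDistribution.fourier_apply,
      Lp.toTemperedDistribution_apply, Lp.toTemperedDistribution_apply,
      ← integral_fourier_mul φ.integrable hg, ← SchwartzMap.fourier_coe, hF]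
    have h5 : ∫ x, 𝓕 φ x • hk.toLp k x = ∫ x, 𝓕 φ x * k x := by
      refine integral_congr_ae ?_
      filter_upwards [hk'] with x hx
      rw [hx, smul_eq_mul]
    rw [h5, ← integral_add h3 h4]
    simp only [Pi.add_apply, smul_eq_mul, mul_add]
  · have hu1 := hu.integrable
    have hc := continuous_fourier hu1
    have hw2 : MemLp (𝓕 fun ξ => (u ξ : ℂ)) 2 := by
      refine (memLp_fourierInv_two hu1 (hu.memLp 2)).of_le hc.aestronglyMeasurable
        (Filter.Eventually.of_forall fun x => ?_)
      rw [← conj_fourierInv_ofReal, RCLike.norm_conj]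
    simp only [conj_fourierInv_ofReal]
    have h1 : Integrable fun x => g x * 𝓕 (fun ξ => (u ξ : ℂ)) x :=
      hg.mul_bdd hc.aestronglyMeasurable (Filter.Eventually.of_forall (norm_fourier_le _))
    have h2 : Integrable fun x => k x * 𝓕 (fun ξ => (u ξ : ℂ)) x := hk.integrable_mul hw2
    have h3 : Integrable fun ξ => 𝓕 g ξ * (u ξ : ℂ) :=
      hu1.bdd_mul hG1 (Filter.Eventually.of_forall (norm_fourier_le g))
    have h4 : Integrable fun ξ => (𝓕 hk.toLp : LpRn n 2) ξ * (u ξ : ℂ) :=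
      (Lp.memLp (𝓕 hk.toLp : LpRn n 2)).integrable_mul (hu.memLp 2)
    have h5 : ∫ x, k x * 𝓕 (fun ξ => (u ξ : ℂ)) x
        = ∫ ξ, (𝓕 hk.toLp : LpRn n 2) ξ * (u ξ : ℂ) := by
      have hpl := Lp.inner_fourier_eq (𝓕⁻ (hu.memLp 2).toLp : LpRn n 2) hk.toLp
      rw [FourierTransform.fourier_fourierInv_eq, L2.inner_def, L2.inner_def] at hpl
      refine Eq.trans ?_ (hpl.symm.trans ?_)
      · refine integral_congr_ae ?_
        filter_upwards [hk', coeFn_fourierInv_toLp hu1 (hu.memLp 2)] with x hx hx'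
        rw [hx, hx', RCLike.inner_apply, conj_fourierInv_ofReal]
      · refine integral_congr_ae ?_
        filter_upwards [(hu.memLp 2).coeFn_toLp] with x hx
        rw [hx, RCLike.inner_apply, Complex.conj_ofReal]
    simp only [hF, Pi.add_apply, add_mul]
    rw [integral_add h1 h2, integral_add h3 h4, h5, integral_fourier_mul hg hu1]

end Transform

end FourierMajorant

namespace FourierMajorant

/-! ### Admissible test functions and the structure of $R(c)$ and its closure. -/

section TestFunctions

variable {n : ℕ} {q : ℝ≥0∞}

/-- Nonnegative bounded functions with bounded support, vanishing a.e. on the set where `c = 0`. -/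
structure IsAdmissible (c : LpRn n q) (u : Rn n → ℝ) : Prop extends IsMultiplier u where
  nonneg : ∀ ξ, 0 ≤ u ξ
  ae_zero : ∀ᵐ ξ : Rn n, c ξ = 0 → u ξ = 0

theorem IsMultiplier.add_smul {u v : Rn n → ℝ} (hu : IsMultiplier u) (hv : IsMultiplier v)
    (a b : ℝ) : IsMultiplier (fun ξ => a * u ξ + b * v ξ) := by
  obtain ⟨M, hM⟩ := hu.bounded
  obtain ⟨M', hM'⟩ := hv.bounded
  refine ⟨(hu.measurable.const_mul a).add (hv.measurable.const_mul b),
    ⟨|a| * M + |b| * M', fun ξ => ?_⟩,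
    (hu.isBounded_support.union hv.isBounded_support).subset fun ξ hξ => ?_⟩
  · refine (abs_add_le _ _).trans ?_
    rw [abs_mul, abs_mul]
    gcongr
    · exact hM ξ
    · exact hM' ξ
  · by_contra h
    rw [Set.mem_union, not_or, Function.notMem_support, Function.notMem_support] at h
    exact hξ (by simp [h.1, h.2])

theorem IsAdmissible.add_smul {c : LpRn n q} {u v : Rn n → ℝ} (hu : IsAdmissible c u)
    (hv : IsAdmissible c v) {a b : ℝ} (ha : 0 ≤ a) (hb : 0 ≤ b) :
    IsAdmissible c (fun ξ => a * u ξ + b * v ξ) := by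
  refine ⟨hu.toIsMultiplier.add_smul hv.toIsMultiplier a b, fun ξ => ?_, ?_⟩
  · have := hu.nonneg ξ
    have := hv.nonneg ξ
    positivity
  · filter_upwards [hu.ae_zero, hv.ae_zero] with ξ h1 h2 h0
    rw [h1 h0, h2 h0]
    ring

/-- Testing with these turns integral inequalities into inequalities of set integrals over arbitrary
measurable $A$, hence into pointwise ones on $\{c\ne0\}$; the ball keeps the support bounded. -/
theorem isAdmissible_indicator (c : LpRn n q) {A : Set (Rn n)} (hA : MeasurableSet A) (N : ℕ) :
    IsAdmissible c ((A ∩ ({ξ | c ξ ≠ 0} ∩ Metric.closedBall 0 N)).indicator fun _ => 1) := by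
  have hc : MeasurableSet {ξ | c ξ ≠ 0} :=
    (Lp.stronglyMeasurable c).measurable (measurableSet_singleton 0).compl
  have hS := hA.inter (hc.inter (Metric.isClosed_closedBall (x := 0) (ε := N)).measurableSet)
  refine ⟨⟨measurable_const.indicator hS, ⟨1, fun ξ => ?_⟩, ?_⟩, fun ξ => ?_, ?_⟩
  · by_cases h : ξ ∈ A ∩ ({ξ | c ξ ≠ 0} ∩ Metric.closedBall 0 N) <;> simp only [h,
      Set.indicator_of_mem, Set.indicator_of_notMem, not_false_eq_true, abs_one, abs_zero, le_refl,
      zero_le_one]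
  · refine (Metric.isBounded_closedBall (x := (0 : Rn n)) (r := N)).subset
      ((Set.support_indicator_subset).trans fun ξ hξ => hξ.2.2)
  · exact Set.indicator_nonneg (fun _ _ => zero_le_one) ξ
  · refine Filter.Eventually.of_forall fun ξ h => Set.indicator_of_notMem ?_ _
    exact fun h' => h'.2.1 h

theorem ae_of_forall_closedBall {P : Rn n → Prop} {c : LpRn n q}
    (h : ∀ N : ℕ, ∀ᵐ ξ ∂(volume.restrict ({ξ | c ξ ≠ 0} ∩ Metric.closedBall 0 N)), P ξ) :
    ∀ᵐ ξ : Rn n, c ξ ≠ 0 → P ξ := by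
  have hc : MeasurableSet {ξ | c ξ ≠ 0} :=
    (Lp.stronglyMeasurable c).measurable (measurableSet_singleton 0).compl
  have h' := fun N : ℕ => (ae_restrict_iff' (hc.inter
    (Metric.isClosed_closedBall (x := (0 : Rn n)) (ε := N)).measurableSet)).1 (h N)
  filter_upwards [ae_all_iff.2 h'] with ξ hξ h0
  obtain ⟨N, hN⟩ := exists_nat_ge ‖ξ‖
  exact hξ N ⟨h0, mem_closedBall_zero_iff.2 hN⟩

theorem integral_mul_indicator_one {G : Rn n → ℂ} {A B : Set (Rn n)} (hA : MeasurableSet A)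
    (hB : MeasurableSet B) :
    ∫ ξ, G ξ * (((A ∩ B).indicator (fun _ => (1 : ℝ)) ξ : ℝ) : ℂ)
      = ∫ ξ in A, G ξ ∂(volume.restrict B) := by
  rw [Measure.restrict_restrict hA, ← integral_indicator (hA.inter hB)]
  congr 1
  ext ξ
  by_cases h : ξ ∈ A ∩ B <;> simp [h]

theorem integral_mul_indicator_one_real {f : Rn n → ℝ} {A B : Set (Rn n)} (hA : MeasurableSet A)
    (hB : MeasurableSet B) :
    ∫ ξ, f ξ * (A ∩ B).indicator (fun _ => (1 : ℝ)) ξ = ∫ ξ in A, f ξ ∂(volume.restrict B) := by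
  rw [Measure.restrict_restrict hA, ← integral_indicator (hA.inter hB)]
  congr 1
  ext ξ
  by_cases h : ξ ∈ A ∩ B <;> simp [h]

theorem measurableSet_inter_closedBall (c : LpRn n q) (N : ℕ) :
    MeasurableSet ({ξ | c ξ ≠ 0} ∩ Metric.closedBall (0 : Rn n) N) :=
  ((Lp.stronglyMeasurable c).measurable (measurableSet_singleton 0).compl).inter
    Metric.isClosed_closedBall.measurableSet

variable [Fact (1 ≤ q)]

theorem mem_R_iff (c w : LpRn n q) :
    w ∈ R c ↔ ∃ u, IsAdmissible c u ∧ ActsBy (𝓕 (toDistrib w)) (fun ξ => (u ξ : ℂ)) ∧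
      ∫ ξ, ‖c ξ‖ * u ξ = 1 := by
  constructor
  · rintro ⟨u, hm, h0, ⟨M, hM⟩, hs, hz, ha, hi⟩
    exact ⟨u, ⟨⟨hm, ⟨M, fun ξ => by rw [abs_of_nonneg (h0 ξ)]; exact hM ξ⟩, hs⟩, h0, hz⟩, ha, hi⟩
  · rintro ⟨u, hu, ha, hi⟩
    obtain ⟨M, hM⟩ := hu.bounded
    exact ⟨u, hu.measurable, hu.nonneg, ⟨M, fun ξ => (le_abs_self _).trans (hM ξ)⟩,
      hu.isBounded_support, hu.ae_zero, ha, hi⟩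

theorem IsMultiplier.integrable_norm_mul {u : Rn n → ℝ} (hu : IsMultiplier u) (c : LpRn n q) :
    Integrable (fun ξ => ‖c ξ‖ * u ξ) := by
  have hc : LocallyIntegrable (fun ξ => ((‖c ξ‖ : ℝ) : ℂ)) :=
    (Lp.memLp c).norm.ofReal.locallyIntegrable Fact.out
  simpa using (hu.integrable_mul hc).re

theorem fourier_toDistrib_smul (w : LpRn n q) (a : ℝ) :
    (𝓕 (toDistrib (a • w)) : 𝓢'(Rn n, ℂ)) = (a : ℂ) • 𝓕 (toDistrib w) := by
  have h : toDistrib (a • w) = (a : ℂ) • toDistrib w := by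
    rw [RCLike.real_smul_eq_coe_smul (K := ℂ) a w]
    exact map_smul (Lp.toTemperedDistributionCLM ℂ (volume : Measure (Rn n)) q) (a : ℂ) w
  rw [h, FourierTransform.fourier_smul]

theorem fourier_toDistrib_add (w w' : LpRn n q) :
    (𝓕 (toDistrib (w + w')) : 𝓢'(Rn n, ℂ)) = 𝓕 (toDistrib w) + 𝓕 (toDistrib w') := by
  have h : toDistrib (w + w') = toDistrib w + toDistrib w' :=
    map_add (Lp.toTemperedDistributionCLM ℂ (volume : Measure (Rn n)) q) w w'
  rw [h, FourierTransform.fourier_add]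

theorem convex_R (c : LpRn n q) : Convex ℝ (R c) := by
  intro w hw w' hw' a b ha hb hab
  rw [mem_R_iff] at hw hw' ⊢
  obtain ⟨u, hu, hact, hint⟩ := hw
  obtain ⟨u', hu', hact', hint'⟩ := hw'
  refine ⟨_, hu.add_smul hu' ha hb, ?_, ?_⟩
  · rw [fourier_toDistrib_add, fourier_toDistrib_smul, fourier_toDistrib_smul]
    simpa using (hact.smul a).add (hact'.smul b)
  · have h1 (ξ : Rn n) : ‖c ξ‖ * (a * u ξ + b * u' ξ)
        = a * (‖c ξ‖ * u ξ) + b * (‖c ξ‖ * u' ξ) := by ring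
    simp only [h1]
    rw [integral_add ((hu.integrable_norm_mul c).const_mul a)
      ((hu'.integrable_norm_mul c).const_mul b), integral_const_mul, integral_const_mul, hint,
      hint', mul_one, mul_one, hab]

theorem IsAdmissible.exists_mem_R {c : LpRn n q} (hq2 : 2 ≤ q) (hq : q ≠ ∞) {u : Rn n → ℝ}
    (hu : IsAdmissible c u) (hpos : 0 < ∫ ξ, ‖c ξ‖ * u ξ) :
    ∃ w ∈ R c, ActsBy (𝓕 (toDistrib w))
      (fun ξ => (((∫ ξ, ‖c ξ‖ * u ξ)⁻¹ * u ξ : ℝ) : ℂ)) := by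
  -- Rescaling of `u`, written as a combination whose second coefficient is $0$.
  have hv := hu.add_smul hu (inv_nonneg.2 hpos.le) le_rfl
  simp only [zero_mul, add_zero] at hv
  have hact := hv.actsBy_fourier (hv.memLp_fourierInv hq2 hq).coeFn_toLp
  refine ⟨_, (mem_R_iff c _).2 ⟨_, hv, hact, ?_⟩, hact⟩
  simp only [mul_left_comm _ (∫ ξ, ‖c ξ‖ * u ξ)⁻¹]
  rw [integral_const_mul, inv_mul_cancel₀ hpos.ne']

theorem locallyIntegrable_norm (c : LpRn n q) : LocallyIntegrable (fun ξ => ‖c ξ‖) :=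
  (Lp.memLp c).norm.locallyIntegrable Fact.out

/-- Otherwise no admissible $u$ has $\int|c|u>0$; taking indicators of $\{c\ne0\}$ cut by balls
forces $c=0$. -/
theorem R_nonempty (hq2 : 2 ≤ q) (hq : q ≠ ∞) {c : LpRn n q} (hc : c ≠ 0) : (R c).Nonempty := by
  by_contra hR
  have hzero (N : ℕ) : ∀ᵐ ξ ∂(volume.restrict ({ξ | c ξ ≠ 0} ∩ Metric.closedBall 0 N)),
      c ξ = 0 := by
    have hS := measurableSet_inter_closedBall c N
    have hu := isAdmissible_indicator c MeasurableSet.univ N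
    have hle : ∫ ξ in ({ξ | c ξ ≠ 0} ∩ Metric.closedBall 0 N), ‖c ξ‖ ≤ 0 := by
      by_contra hpos
      rw [not_le, ← setIntegral_univ,
        ← integral_mul_indicator_one_real MeasurableSet.univ hS] at hpos
      obtain ⟨w, hw, -⟩ := hu.exists_mem_R hq2 hq hpos
      exact hR ⟨w, hw⟩
    have hint : IntegrableOn (fun ξ => ‖c ξ‖) ({ξ | c ξ ≠ 0} ∩ Metric.closedBall (0 : Rn n) N) :=
      ((locallyIntegrable_iff.1 (locallyIntegrable_norm c)) _ (isCompact_closedBall _ _)).mono_set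
        Set.inter_subset_right
    have h0 := (integral_eq_zero_iff_of_nonneg (fun ξ => norm_nonneg _) hint).1
      (le_antisymm hle (integral_nonneg fun ξ => norm_nonneg _))
    filter_upwards [h0] with ξ hξ
    exact norm_eq_zero.1 hξ
  refine hc (Lp.eq_zero_iff_ae_eq_zero.2 ?_)
  filter_upwards [ae_of_forall_closedBall hzero] with ξ hξ
  by_contra h
  exact h (hξ h)

theorem K_eq_norm {c : LpRn n q} {h : LpRn n q} (hh : IsMinNorm (closure (R c)) h) :
    K c = ‖h‖ := by
  have hne : (R c).Nonempty := closure_nonempty_iff.1 ⟨h, hh.1⟩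
  have hbdd : BddBelow ((fun w : LpRn n q => ‖w‖) '' R c) :=
    ⟨0, by rintro _ ⟨w, -, rfl⟩; exact norm_nonneg _⟩
  refine le_antisymm ?_ (le_csInf (hne.image _) ?_)
  · have hcl : IsClosed {w : LpRn n q | K c ≤ ‖w‖} := isClosed_le continuous_const continuous_norm
    refine closure_minimal (fun w hw => ?_) hcl hh.1
    exact csInf_le hbdd ⟨w, hw, rfl⟩
  · rintro _ ⟨w, hw, rfl⟩
    exact hh.2 w (subset_closure hw)

/-- Inverse transforms of real functions have this symmetry, and it is a closed condition. It later
makes the transform of $h|h|^{q-2}$ real where $c\ne0$. -/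
theorem conj_eq_comp_neg (hq2 : 2 ≤ q) (hq : q ≠ ∞) {c w : LpRn n q} (hw : w ∈ closure (R c)) :
    ∀ᵐ x : Rn n, starRingEnd ℂ (w x) = w (-x) := by
  let C : LpRn n q →L[ℝ] LpRn n q :=
    ContinuousLinearMap.compLpL q volume (Complex.conjCLE : ℂ →L[ℝ] ℂ)
  have hneg := Measure.measurePreserving_neg (volume : Measure (Rn n))
  have hC (v : LpRn n q) : C v =ᵐ[volume] fun x => starRingEnd ℂ (v x) :=
    ContinuousLinearMap.coeFn_compLpL _ _
  have hcl : IsClosed {v : LpRn n q | C v = Lp.compMeasurePreserving Neg.neg hneg v} :=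
    isClosed_eq C.continuous (Lp.isometry_compMeasurePreserving hneg).continuous
  have hmem : C w = Lp.compMeasurePreserving Neg.neg hneg w := by
    refine closure_minimal (fun v hv => ?_) hcl hw
    obtain ⟨u, hu, hact, -⟩ := (mem_R_iff c v).1 hv
    have hv' := hu.coeFn_of_actsBy hq2 hq hact
    refine Lp.ext ?_
    filter_upwards [hC v, Lp.coeFn_compMeasurePreserving v hneg, hv',
      hneg.quasiMeasurePreserving.ae hv'] with x h1 h2 h3 h4
    rw [h1, h2, Function.comp_apply, h3, h4, conj_fourierInv_ofReal, Real.fourierInv_eq_fourier_neg,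
      neg_neg]
  filter_upwards [hC w, Lp.coeFn_compMeasurePreserving w hneg] with x h1 h2
  rw [← h1, hmem, h2, Function.comp_apply]

/-- On an open set where $c$ vanishes, so does every $\hat w$ with $w\in R(c)$; evaluation of $\hat
w$ at a fixed Schwartz function is continuous in $w$, so this passes to the closure. -/
theorem dsupport_fourier_subset {c h : LpRn n q} (hh : h ∈ closure (R c)) :
    Distribution.dsupport (𝓕 (toDistrib h) : 𝓢'(Rn n, ℂ))
      ⊆ Distribution.dsupport (toDistrib c) := by
  intro x hx
  by_contra hxc
  rw [Distribution.notMem_dsupport_iff] at hxc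
  obtain ⟨s, hvan, hs, hxs⟩ := hxc
  refine (Distribution.notMem_dsupport_iff x).2 ⟨s, fun φ hφ => ?_, hs, hxs⟩ hx
  have hc0 : ∀ᵐ ξ : Rn n, ξ ∈ s → c ξ = 0 := by
    refine hs.ae_eq_zero_of_integral_contDiff_smul_eq_zero
      (((Lp.memLp c).locallyIntegrable Fact.out).locallyIntegrableOn s) fun g hg hgc hgs => ?_
    have hg₁ : HasCompactSupport (Complex.ofRealCLM ∘ g) := hgc.comp_left rfl
    have hg₂ : ContDiff ℝ ((⊤ : ℕ∞) : WithTop ℕ∞) (Complex.ofRealCLM ∘ g) :=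
      Complex.ofRealCLM.contDiff.comp hg
    have h1 := hvan (hg₁.toSchwartzMap hg₂) ((closure_mono
      (Function.support_comp_subset (map_zero Complex.ofRealCLM) g)).trans hgs)
    simpa using h1
  have hcl : IsClosed {w : LpRn n q | (𝓕 (toDistrib w) : 𝓢'(Rn n, ℂ)) φ = 0} := by
    refine isClosed_eq ?_ continuous_const
    exact (PointwiseConvergenceCLM.evalCLM _ _ (𝓕 φ)).continuous.comp
      (Lp.toTemperedDistributionCLM ℂ (volume : Measure (Rn n)) q).continuous
  refine closure_minimal (fun w hw => ?_) hcl hh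
  obtain ⟨u, hu, hact, -⟩ := (mem_R_iff c w).1 hw
  refine (hact φ).2.trans (integral_eq_zero_of_ae ?_)
  filter_upwards [hc0, hu.ae_zero] with ξ h1 h2
  by_cases hξ : ξ ∈ s
  · simp [h2 (h1 hξ)]
  · simp [image_eq_zero_of_notMem_tsupport fun h => hξ (hφ h)]

end TestFunctions

/-! ### Pairing partial majorants with $R(c)$. -/

section Majorants

variable {n : ℕ} {p q : ℝ≥0∞}

/-- The substitution $x\mapsto-x$ shows that the integral equals its own conjugate. -/
theorem im_integral_eq_zero {F : LpRn n p} {w : LpRn n q}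
    (hF : ∀ᵐ x : Rn n, starRingEnd ℂ (F x) = F (-x))
    (hw : ∀ᵐ x : Rn n, starRingEnd ℂ (w x) = w (-x)) :
    (∫ x, F x * starRingEnd ℂ (w x)).im = 0 := by
  rw [← Complex.conj_eq_iff_im, ← integral_conj, ← integral_neg_eq_self]
  refine integral_congr_ae ?_
  have hneg := (Measure.measurePreserving_neg
    (volume : Measure (Rn n))).quasiMeasurePreserving
  filter_upwards [hneg.ae hF, hneg.ae hw, hF, hw] with x h1 h2 h3 h4
  rw [neg_neg] at h1 h2
  rw [map_mul, Complex.conj_conj, h1, ← h4]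

theorem conj_dualMap (hpq : p.toReal.HolderConjugate q.toReal) {h : LpRn n q}
    (hh : ∀ᵐ x : Rn n, starRingEnd ℂ (h x) = h (-x)) :
    ∀ᵐ x : Rn n, starRingEnd ℂ (dualMap hpq h x) = dualMap hpq h (-x) := by
  have hneg := (Measure.measurePreserving_neg
    (volume : Measure (Rn n))).quasiMeasurePreserving
  filter_upwards [coeFn_dualMap hpq h, hneg.ae (coeFn_dualMap hpq h), hh] with x h1 h2 h3
  rw [h1, h2, ← h3, map_mul, Complex.conj_ofReal, RCLike.norm_conj]

variable [Fact (1 ≤ p)] [Fact (1 ≤ q)]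

theorem norm_smul_dualMap (hpq : p.toReal.HolderConjugate q.toReal) {h : LpRn n q}
    (hpos : 0 < ‖h‖) : ‖(‖h‖ ^ q.toReal)⁻¹ • dualMap hpq h‖ = 1 / ‖h‖ := by
  rw [norm_smul, norm_dualMap, Real.norm_of_nonneg (by positivity), Real.rpow_sub_one hpos.ne']
  have : ‖h‖ ^ q.toReal ≠ 0 := by positivity
  field_simp

theorem integral_mul_conj_eq (hp2 : p ≤ 2) (hq2 : 2 ≤ q) (hq : q ≠ ∞) {F : LpRn n p}
    {G : Rn n → ℂ} (hG : ActsBy (𝓕 (toDistrib F)) G) {w : LpRn n q} {u : Rn n → ℝ}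
    (hu : IsMultiplier u) (hw : ActsBy (𝓕 (toDistrib w)) (fun ξ => (u ξ : ℂ))) :
    ∫ x, F x * starRingEnd ℂ (w x) = ∫ ξ, G ξ * (u ξ : ℂ) := by
  obtain ⟨G', hG', hpar⟩ := exists_actsBy_fourier hp2 F
  have h1 : ∫ ξ, G ξ * (u ξ : ℂ) = ∫ ξ, G' ξ * (u ξ : ℂ) := by
    refine integral_congr_ae ?_
    filter_upwards [hG.ae_eq hG'] with ξ hξ
    rw [hξ]
  rw [h1, ← hpar u hu]
  refine integral_congr_ae ?_
  filter_upwards [hu.coeFn_of_actsBy hq2 hq hw] with x hx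
  rw [hx]

variable [p.HolderConjugate q]

theorem realPairing_eq_re (F : LpRn n p) (w : LpRn n q) :
    realPairing volume p q F w = (∫ x, F x * starRingEnd ℂ (w x)).re := by
  have hint : Integrable fun x => F x * starRingEnd ℂ (w x) :=
    (Lp.memLp F).integrable_mul (Lp.memLp w).star
  rw [realPairing_apply]
  refine Eq.trans ?_ (integral_re hint)
  congr 1
  ext x
  rw [real_inner_comm, Complex.inner]
  simp

theorem one_le_realPairing (hp2 : p ≤ 2) (hq2 : 2 ≤ q) (hq : q ≠ ∞) {c : LpRn n q} {F : LpRn n p}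
    (hF : F ∈ partialMajorants p c) {h : LpRn n q} (hh : h ∈ closure (R c)) :
    1 ≤ realPairing volume p q F h := by
  obtain ⟨G, hact, hG⟩ := hF
  have hcl : IsClosed {w : LpRn n q | 1 ≤ realPairing volume p q F w} :=
    isClosed_le continuous_const (realPairing volume p q F).continuous
  refine closure_minimal (fun w hw => ?_) hcl hh
  obtain ⟨u, hu, hwu, hint⟩ := (mem_R_iff c w).1 hw
  have hGu := hu.integrable_mul hact.locallyIntegrable
  have hre : (∫ ξ, G ξ * (u ξ : ℂ)).re = ∫ ξ, (G ξ).re * u ξ := by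
    refine (integral_re hGu).symm.trans ?_
    simp
  rw [Set.mem_ofPred_eq, realPairing_eq_re,
    integral_mul_conj_eq hp2 hq2 hq hact hu.toIsMultiplier hwu, hre, ← hint]
  refine integral_mono_ae (hu.integrable_norm_mul c) (by simpa using hGu.re) ?_
  filter_upwards [hG, hu.ae_zero] with ξ h1 h2
  by_cases hξ : c ξ = 0
  · simp [h2 hξ]
  · exact mul_le_mul_of_nonneg_right (h1 hξ).2 (hu.nonneg ξ)

theorem smul_dualMap_mem_partialMajorants (hpq : p.toReal.HolderConjugate q.toReal) (hp2 : p ≤ 2)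
    (hq2 : 2 ≤ q) (hq : q ≠ ∞) {c h : LpRn n q} (hh : IsMinNorm (closure (R c)) h)
    (hpos : 0 < ‖h‖) :
    (‖h‖ ^ q.toReal)⁻¹ • dualMap hpq h ∈ partialMajorants p c := by
  have hr : 2 ≤ q.toReal := by simpa using ENNReal.toReal_mono hq hq2
  obtain ⟨G, hact, -⟩ := exists_actsBy_fourier hp2 (dualMap hpq h)
  set κ : ℝ := ‖h‖ ^ q.toReal with hκ
  have hκpos : 0 < κ := by positivity
  have hsym := conj_dualMap hpq (conj_eq_comp_neg hq2 hq hh.1)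
  -- The first-order condition at $h$ in homogeneous form, free of the normalisation $\int|c|u=1$.
  -- If $\int|c|u=0$ then $u=0$ almost everywhere, since $u$ vanishes where $c$ does; otherwise $u$
  -- is rescaled into $R(c)$.
  have key {u : Rn n → ℝ} (hu : IsAdmissible c u) : (∫ ξ, G ξ * (u ξ : ℂ)).im = 0 ∧
      κ * ∫ ξ, ‖c ξ‖ * u ξ ≤ (∫ ξ, G ξ * (u ξ : ℂ)).re := by
    have hnn (ξ : Rn n) : 0 ≤ ‖c ξ‖ * u ξ := mul_nonneg (norm_nonneg _) (hu.nonneg ξ)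
    rcases (integral_nonneg (μ := volume) (f := fun ξ => ‖c ξ‖ * u ξ) hnn).eq_or_lt with h0 | h0
    · have hz : ∫ ξ, G ξ * (u ξ : ℂ) = 0 := by
        refine integral_eq_zero_of_ae ?_
        filter_upwards [(integral_eq_zero_iff_of_nonneg hnn (hu.integrable_norm_mul c)).1 h0.symm,
          hu.ae_zero] with ξ h1 h2
        rcases mul_eq_zero.1 h1 with h3 | h3
        · simp [h2 (norm_eq_zero.1 h3)]
        · simp [h3]
      simp [hz, ← h0]
    · obtain ⟨w, hw, hwu⟩ := hu.exists_mem_R hq2 hq h0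
      have hwu' := hu.toIsMultiplier.add_smul hu.toIsMultiplier (∫ ξ, ‖c ξ‖ * u ξ)⁻¹ 0
      simp only [zero_mul, add_zero] at hwu'
      have h1 := integral_mul_conj_eq hp2 hq2 hq hact hwu' hwu
      have h2 := norm_rpow_le_realPairing_dualMap hpq hr (convex_R c).closure hh (subset_closure hw)
      have h3 := im_integral_eq_zero hsym (conj_eq_comp_neg hq2 hq (subset_closure hw))
      rw [realPairing_eq_re] at h2
      simp only [Complex.ofReal_mul, mul_left_comm _ (((∫ ξ, ‖c ξ‖ * u ξ)⁻¹ : ℝ) : ℂ)] at h1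
      rw [integral_const_mul] at h1
      rw [h1, Complex.re_ofReal_mul] at h2
      rw [h1, Complex.im_ofReal_mul] at h3
      refine ⟨(mul_eq_zero.1 h3).resolve_left (inv_ne_zero h0.ne'), ?_⟩
      rwa [← div_eq_inv_mul, le_div_iff₀ h0] at h2
  have hGint (N : ℕ) : IntegrableOn G ({ξ | c ξ ≠ 0} ∩ Metric.closedBall (0 : Rn n) N) :=
    ((locallyIntegrable_iff.1 hact.locallyIntegrable) _ (isCompact_closedBall _ _)).mono_set
      Set.inter_subset_right
  have hcint (N : ℕ) : IntegrableOn (fun ξ => ‖c ξ‖)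
      ({ξ | c ξ ≠ 0} ∩ Metric.closedBall (0 : Rn n) N) :=
    ((locallyIntegrable_iff.1 (locallyIntegrable_norm c)) _ (isCompact_closedBall _ _)).mono_set
      Set.inter_subset_right
  -- Here and for the real part, `key` is applied to indicators, so the set integrals over every
  -- measurable `A` decide the pointwise claim.
  have him : ∀ᵐ ξ : Rn n, c ξ ≠ 0 → (G ξ).im = 0 := by
    refine ae_of_forall_closedBall fun N => ?_
    refine Integrable.ae_eq_zero_of_forall_setIntegral_eq_zero (hGint N).im fun A hA _ => ?_
    have h1 := (key (isAdmissible_indicator c hA N)).1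
    rw [integral_mul_indicator_one hA (measurableSet_inter_closedBall c N)] at h1
    exact (integral_im (hGint N).integrableOn).trans h1
  have hre : ∀ᵐ ξ : Rn n, c ξ ≠ 0 → κ * ‖c ξ‖ ≤ (G ξ).re := by
    refine ae_of_forall_closedBall fun N => ?_
    refine ae_le_of_forall_setIntegral_le ((hcint N).const_mul κ) (hGint N).re fun A hA _ => ?_
    have h1 := (key (isAdmissible_indicator c hA N)).2
    rw [integral_mul_indicator_one hA (measurableSet_inter_closedBall c N),
      integral_mul_indicator_one_real hA (measurableSet_inter_closedBall c N)] at h1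
    rw [integral_const_mul]
    exact h1.trans (integral_re (hGint N).integrableOn).symm.le
  refine ⟨fun ξ => ((κ⁻¹ : ℝ) : ℂ) * G ξ, ?_, ?_⟩
  · rw [fourier_toDistrib_smul]
    exact hact.smul _
  · filter_upwards [him, hre] with ξ h1 h2 h0
    rw [Complex.im_ofReal_mul, Complex.re_ofReal_mul, h1 h0, mul_zero]
    refine ⟨rfl, ?_⟩
    rw [← div_eq_inv_mul, le_div_iff₀ hκpos, mul_comm]
    exact h2 h0

end Majorants

end FourierMajorant

/-! ### Assembly of the four claims. -/

theorem lemmaA2 {n : ℕ} {p q : ℝ≥0∞} [Fact (1 ≤ p)] [Fact (1 ≤ q)]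
    (hpq : p.HolderConjugate q) (hp1 : 1 < p) (hp2 : p < 2)
    (c : FourierMajorant.LpRn n q) (hc : c ≠ 0) :
    ((FourierMajorant.partialMajorants p c).Nonempty ↔ 0 < FourierMajorant.K c) ∧
    (∃! h : FourierMajorant.LpRn n q,
      FourierMajorant.IsMinNorm (closure (FourierMajorant.R c)) h) ∧
    (0 < FourierMajorant.K c →
      (∃! F : FourierMajorant.LpRn n p,
        FourierMajorant.IsMinNorm (FourierMajorant.partialMajorants p c) F) ∧
      ∀ F : FourierMajorant.LpRn n p,
        FourierMajorant.IsMinNorm (FourierMajorant.partialMajorants p c) F →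
        ‖F‖ = 1 / FourierMajorant.K c ∧
        ∀ h : FourierMajorant.LpRn n q,
          FourierMajorant.IsMinNorm (closure (FourierMajorant.R c)) h →
          ∃ a : ℝ, 0 < a ∧
            ∀ᵐ x : FourierMajorant.Rn n,
              F x = (a : ℂ) * (h x * ((‖h x‖ ^ (q.toReal - 2) : ℝ) : ℂ))) ∧
    (∀ h : FourierMajorant.LpRn n q,
      FourierMajorant.IsMinNorm (closure (FourierMajorant.R c)) h →
      Distribution.dsupport (𝓕 (FourierMajorant.toDistrib h) : 𝓢'(FourierMajorant.Rn n, ℂ)) ⊆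
        Distribution.dsupport (FourierMajorant.toDistrib c)) := by
  have hp : p ≠ ∞ := (hp2.trans (by norm_num)).ne
  have hr1 : 1 < p.toReal := by
    simpa using (ENNReal.toReal_lt_toReal (by norm_num) hp).2 hp1
  have hr2 : p.toReal < 2 := by
    simpa using (ENNReal.toReal_lt_toReal hp (by norm_num)).2 hp2
  have hpqr : p.toReal.HolderConjugate q.toReal := ENNReal.HolderConjugate.toReal hr1
  have hq : q ≠ ∞ := (ENNReal.toReal_pos_iff.1 hpqr.symm.pos).2.ne
  have hrq : 2 ≤ q.toReal := by nlinarith [hpqr.mul_eq_add, hpqr.symm.lt]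
  have hq2 : 2 ≤ q := by
    rw [← ENNReal.ofReal_toReal hq]
    simpa using ENNReal.ofReal_le_ofReal hrq
  obtain ⟨h, hh, huniq⟩ := FourierMajorant.existsUnique_isMinNorm hq2 hq
    (FourierMajorant.convex_R c).closure isClosed_closure
    (FourierMajorant.R_nonempty hq2 hq hc).closure
  have hK := FourierMajorant.K_eq_norm hh
  have hlow (F : FourierMajorant.LpRn n p) (hF : F ∈ FourierMajorant.partialMajorants p c) :
      1 ≤ FourierMajorant.realPairing volume p q F h :=
    FourierMajorant.one_le_realPairing hp2.le hq2 hq hF hh.1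
  refine ⟨⟨fun ⟨F, hF⟩ => ?_, fun hpos => ?_⟩, ⟨h, hh, huniq⟩, fun hpos => ?_, fun h' hh' => ?_⟩
  · rw [hK]
    refine lt_of_le_of_ne (norm_nonneg _) fun h0 => ?_
    have := (hlow F hF).trans (FourierMajorant.realPairing_le F h)
    rw [← h0, mul_zero] at this
    linarith
  · exact ⟨_, FourierMajorant.smul_dualMap_mem_partialMajorants hpqr hp2.le hq2 hq hh (hK ▸ hpos)⟩
  · rw [hK] at hpos ⊢
    set F₀ := (‖h‖ ^ q.toReal)⁻¹ • FourierMajorant.dualMap hpqr h with hF₀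
    have hmem : F₀ ∈ FourierMajorant.partialMajorants p c :=
      FourierMajorant.smul_dualMap_mem_partialMajorants hpqr hp2.le hq2 hq hh hpos
    have hnorm : ‖F₀‖ = 1 / ‖h‖ := FourierMajorant.norm_smul_dualMap hpqr hpos
    have hmin : FourierMajorant.IsMinNorm (FourierMajorant.partialMajorants p c) F₀ := by
      refine ⟨hmem, fun F hF => ?_⟩
      rw [hnorm, div_le_iff₀ hpos]
      exact (hlow F hF).trans (FourierMajorant.realPairing_le F h)
    have heq (F : FourierMajorant.LpRn n p)
        (hF : FourierMajorant.IsMinNorm (FourierMajorant.partialMajorants p c) F) : F = F₀ := by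
      -- Minimality against `F₀` gives $\|F\|\|h\|\le1$, while the pairing is at least $1$: Hölder
      -- is an equality.
      refine FourierMajorant.eq_smul_dualMap hpqr hrq ?_ (hlow F hF.1)
      rw [← le_div_iff₀ hpos, ← hnorm]
      exact hF.2 _ hmem
    refine ⟨⟨F₀, hmin, heq⟩, fun F hF => ⟨heq F hF ▸ hnorm, fun h' hh' => ?_⟩⟩
    rw [huniq h' hh', heq F hF]
    refine ⟨(‖h‖ ^ q.toReal)⁻¹, by positivity, ?_⟩
    filter_upwards [Lp.coeFn_smul (‖h‖ ^ q.toReal)⁻¹ (FourierMajorant.dualMap hpqr h),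
      FourierMajorant.coeFn_dualMap hpqr h] with x h1 h2
    rw [hF₀, h1, Pi.smul_apply, h2, Complex.real_smul]
  · exact FourierMajorant.dsupport_fourier_subset hh'.1
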